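/- **Setting.** Consider tuples $\mathbf B=(B_1,\dots,B_p)$ of endomorphisms of a finite dimensional complex vector space $V$ (the residue matrices of $\frac{du}{dx}=\sum_j\frac{B_j}{x-t_j}u$); $\dim V$ is the rank, written $\operatorname{ord}\mathbf B$. Write $\mathbf B\sim\mathbf C$ for simultaneous conjugacy; call $\mathbf B$ irreducible if the only subspaces invariant under all $B_j$ are $0$ and $V$. Define * the addition $M_\mu(\mathbf B)=(B_1+\mu_1,\dots,B_p+\mu_p)$ for $\mu\in\mathbb C^p$; * $T_{(j,\infty)}(\mathbf B)$, obtained from $\mathbf B$ by replacing $B_j$ by $-(B_1+\dots+B_p)$; * the middle convolution $mc_\lambda(\mathbf B)$, $\lambda\in\mathbb C$: let $G_j\in\operatorname{End}(V^p)$ be the block matrix whose $j$-th block row is $(B_1,\dots,B_{j-1},B_j+\lambda,B_{j+1},\dots,B_p)$ and whose other rows vanish, $\mathcal K=\{(u_i)\in V^p: B_iu_i=0\ \forall i\}$ and $\mathcal L_\lambda=\ker(G_1+\dots+G_p)$; then $mc_\lambda(\mathbf B)$ is the tuple of maps induced by $G_1,\dots,G_p$ on $V^p/(\mathcal K+\mathcal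 L_\lambda)$. A system of Okubo normal form (ONF) $(x-T)\frac{du}{dx}=Au$ with $p$ finite points is given by a decomposition $V=V_1\oplus\dots\oplus V_p$ (with $T=t_i$ on $V_i$; some $V_i$ may be $0$) and $A\in\operatorname{End}(V)$, with blocks $A_{ik}\colon V_k\to V_i$. It is identified with the tuple $\mathbf A=(A_1,\dots,A_p)$, $A_i=P_iA$, where $P_i$ is the projection onto $V_i$; it is called linearly irreducible if $\mathbf A$ is irreducible. On systems of ONF define * the generic Euler transformation $E_\epsilon\colon A\mapsto A+\epsilon$, defined when $-\epsilon$ is not an eigenvalue of $A$; * the extension $E^p_{\rho_1,\rho_2}$ (for $\rho_1\rho_2\neq0$, applied to linearly irreducible systems with $A$ invertible), whose result has the $p+1$ blocks $V_1,\dots,V_p,V_{p+1}=\operatorname{Im}(A-\rho_1)(A-\rho_2)$ and the matrix $$\hat A=\begin{pmatrix}A& I\\ -(A-\rho_1)(A-\rho_2)&\rho_1+\rho_2-A\end{pmatrix}\quad\text{on } V\oplus \operatorname{Im}(A-\rho_1)(A-\rho_2);$$ * the restriction $R^{p+1}$ of a system with $p+1$ blocks, which deletes the $(p+1)$-st block row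 and block column of $A$. It is defined when the system is linearly irreducible and there are $\mu_1,\mu_2\in\mathbb C$ such that $(A-\mu_1)(A-\mu_2)=0$ and $\mu_1+\mu_2$ is not an eigenvalue of $A_{p+1,p+1}$. Put $R^{p+1}_j=R^{p+1}\circ T_{(j,p+1)}$, where $T_{(j,p+1)}$ interchanges the $j$-th and the $(p+1)$-st block. **Statement.** Let $\mathbf A$ be a linearly irreducible system of ONF of rank $\operatorname{ord}\mathbf A\ge2$ with $p$ finite points, let $1\le j\le p$, and let $\rho_1,\rho_2$ be non-zero complex numbers. 1. For all $\epsilon\in\mathbb C$ outside a finite set, every operation in $R^{p+1}_j\circ E_\epsilon\circ E^p_{\rho_1,\rho_2}(\mathbf A)$ is defined, and $$R^{p+1}_j\circ E_\epsilon\circ E^p_{\rho_1,\rho_2}(\mathbf A)\ \sim\ mc_{\rho_1+\epsilon}\circ M_{(0,\dots,0,\rho_2-\rho_1,0,\dots,0)}\circ T_{(j,\infty)}\circ mc_{-\rho_1}(\mathbf A),$$ $$\operatorname{ord}\,R^{p+1}_j\circ E_\epsilon\circ E^p_{\rho_1,\rho_2}(\mathbf A)=\operatorname{ord}\mathbf A+\dim\operatorname{Im}(A-\rho_1)(A-\rho_2)-\dim\operatorname{Im}A_j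 .$$ 2. For every $\rho_3\in\mathbb C$ and all $\epsilon\in\mathbb C$ outside a finite set, every operation on the left hand side of the following relation is defined, and $$R^{p+1}_j\circ E^p_{\rho_1+\epsilon,\,\rho_1+\rho_2+\rho_3+\epsilon}\circ R^{p+1}_j\circ E_\epsilon\circ E^p_{\rho_1,\rho_2}(\mathbf A)\ \sim\ mc_{\rho_1+\epsilon}\circ M_{(0,\dots,0,\rho_1+\rho_3,0,\dots,0)}\circ mc_{-\rho_1}(\mathbf A).$$ In both parts the non-zero entry of the index of $M$ stands at the place $j$. -/

import Mathlib

universe u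

/-- A tuple `(A₁, …, A_p)` of endomorphisms of a finite dimensional complex vector space `V`:
the residue matrices of the Schlesinger canonical form `du/dx = ∑ A_j / (x - t_j) u`. -/
structure ResidueTuple (p : ℕ) where
  V : Type u
  [addCommGroup : AddCommGroup V]
  [module : Module ℂ V]
  [finiteDimensional : FiniteDimensional ℂ V]
  mat : Fin p → Module.End ℂ V

namespace ResidueTuple

attribute [instance] ResidueTuple.addCommGroup ResidueTuple.module
  ResidueTuple.finiteDimensional

variable {p : ℕ}

/-- The rank (`ord`) of the system. -/
noncomputable def rank (B : ResidueTuple.{u} p) : ℕ := Module.finrank ℂ B.V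

/-- `B ∼ C`: simultaneous conjugacy. -/
def Sim (B C : ResidueTuple.{u} p) : Prop :=
  ∃ g : B.V ≃ₗ[ℂ] C.V, ∀ (i : Fin p) (v : B.V), g (B.mat i v) = C.mat i (g v)

/-- The only common invariant subspaces are `0` and `V`. -/
def IsIrred (B : ResidueTuple.{u} p) : Prop :=
  ∀ W : Submodule ℂ B.V, (∀ i, ∀ v ∈ W, B.mat i v ∈ W) → W = ⊥ ∨ W = ⊤

/-- The addition `M_μ`. -/
def addition (μ : Fin p → ℂ) (B : ResidueTuple.{u} p) : ResidueTuple.{u} p where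
  V := B.V
  mat i := B.mat i + μ i • 1

/-- `T_{(j,∞)}`: the `j`-th entry is replaced by the residue `-(B₁ + ⋯ + B_p)` at infinity. -/
def swapInfty (j : Fin p) (B : ResidueTuple.{u} p) : ResidueTuple.{u} p where
  V := B.V
  mat := Function.update B.mat j (-∑ i, B.mat i)

/-- The convolution matrix `G_j`: the only non-zero block row is the `j`-th one, which is
`(A₁, …, A_j + lam, …, A_p)`. -/
def conv (lam : ℂ) (B : ResidueTuple.{u} p) (j : Fin p) : Module.End ℂ (Fin p → B.V) :=
  LinearMap.single ℂ (fun _ : Fin p => B.V) j ∘ₗ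
    (∑ i, B.mat i ∘ₗ LinearMap.proj i + lam • LinearMap.proj j)

/-- `𝒦 = {(u₁, …, u_p) : A_j u_j = 0 for all j}`. -/
def convK (B : ResidueTuple.{u} p) : Submodule ℂ (Fin p → B.V) :=
  Submodule.pi Set.univ fun i => LinearMap.ker (B.mat i)

/-- `ℒ_lam = ker (G₁ + ⋯ + G_p)`. -/
def convL (lam : ℂ) (B : ResidueTuple.{u} p) : Submodule ℂ (Fin p → B.V) :=
  LinearMap.ker (∑ j, conv lam B j)

theorem conv_apply (lam : ℂ) (B : ResidueTuple.{u} p) (j : Fin p) (w : Fin p → B.V) :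
    conv lam B j w = Pi.single j (∑ i, B.mat i (w i) + lam • w j) := by
  simp [conv]

theorem convK_sup_convL_le (lam : ℂ) (B : ResidueTuple.{u} p) (j : Fin p) :
    convK B ⊔ convL lam B ≤ (convK B ⊔ convL lam B).comap (conv lam B j) := by
  refine sup_le ?_ ?_
  · intro w hw
    refine Submodule.mem_sup_left ?_
    have hw' : ∀ i, B.mat i (w i) = 0 := by
      intro i
      simpa using (Submodule.mem_pi.1 hw) i (Set.mem_univ i)
    rw [conv_apply]
    refine Submodule.mem_pi.2 fun i _ => ?_
    rcases eq_or_ne i j with rfl | h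
    · simp [hw']
    · simp [Pi.single_eq_of_ne h]
  · intro w hw
    have h0 : ∑ k, conv lam B k w = 0 := by
      simpa [convL, LinearMap.sum_apply] using hw
    have hj := congrFun h0 j
    rw [Finset.sum_apply, Finset.sum_eq_single j] at hj
    · rw [conv_apply, Pi.single_eq_same] at hj
      rw [Submodule.mem_comap, conv_apply, hj]
      simp
    · intro k _ hk
      rw [conv_apply, Pi.single_eq_of_ne hk.symm]
    · simp

/-- The middle convolution `mc_lam`: the maps induced by `G₁, …, G_p` on
`V^p / (𝒦 + ℒ_lam)`. -/
def mc (lam : ℂ) (B : ResidueTuple.{u} p) : ResidueTuple.{u} p where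
  V := (Fin p → B.V) ⧸ (convK B ⊔ convL lam B)
  mat j := (convK B ⊔ convL lam B).mapQ (convK B ⊔ convL lam B) (conv lam B j)
    (convK_sup_convL_le lam B j)

end ResidueTuple

/-- A system `(x - T) du/dx = A u` of Okubo normal form with `T = ∑ t_i P_i`: `P_i` is the
projection onto the `i`-th block `ℂ^{n_i}` of `V = ℂ^{n₁} ⊕ ⋯ ⊕ ℂ^{n_p}`, on which `T` is `t_i`
(some `n_i` may be zero). The positions of the points `t_i` do not enter any of the operations. -/
structure OkuboSystem (p : ℕ) where
  V : Type u
  [addCommGroup : AddCommGroup V]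
  [module : Module ℂ V]
  [finiteDimensional : FiniteDimensional ℂ V]
  proj : Fin p → Module.End ℂ V
  complete : CompleteOrthogonalIdempotents proj
  A : Module.End ℂ V

namespace OkuboSystem

attribute [instance] OkuboSystem.addCommGroup OkuboSystem.module
  OkuboSystem.finiteDimensional

variable {p : ℕ}

/-- The rank (`ord`) of the system. -/
noncomputable def rank (S : OkuboSystem.{u} p) : ℕ := Module.finrank ℂ S.V

/-- The Schlesinger form of the system: `A_i` is the `i`-th block row of `A`, all other rows
being zero. -/
def toTuple (S : OkuboSystem.{u} p) : ResidueTuple.{u} p where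
  V := S.V
  mat i := S.proj i * S.A

/-- Linear irreducibility. -/
def IsLinIrred (S : OkuboSystem.{u} p) : Prop := S.toTuple.IsIrred

/-- The Euler transformation `E_ε : A ↦ A + ε`. -/
def euler (ε : ℂ) (S : OkuboSystem.{u} p) : OkuboSystem.{u} p where
  V := S.V
  proj := S.proj
  complete := S.complete
  A := S.A + ε • 1

/-- `E_ε` is a generic Euler transformation for `S`. -/
def EulerDefined (ε : ℂ) (S : OkuboSystem.{u} p) : Prop := ¬ S.A.HasEigenvalue (-ε)

/-- `(A - ρ₁)(A - ρ₂)`. -/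
def quad (ρ₁ ρ₂ : ℂ) (S : OkuboSystem.{u} p) : Module.End ℂ S.V :=
  (S.A - ρ₁ • 1) * (S.A - ρ₂ • 1)

theorem A_mem_range_quad (ρ₁ ρ₂ : ℂ) (S : OkuboSystem.{u} p) :
    ∀ v ∈ LinearMap.range (S.quad ρ₁ ρ₂), S.A v ∈ LinearMap.range (S.quad ρ₁ ρ₂) := by
  rintro _ ⟨w, rfl⟩
  refine ⟨S.A w, ?_⟩
  have h : S.quad ρ₁ ρ₂ * S.A = S.A * S.quad ρ₁ ρ₂ := by
    simp only [quad, sub_mul, mul_sub, smul_mul_assoc, mul_smul_comm, one_mul, mul_one,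
      mul_assoc]
  exact LinearMap.congr_fun h w

/-- The projections onto the blocks of the extended system: the old ones, and the one onto the
new block. -/
def extProj (S : OkuboSystem.{u} p) (R : Submodule ℂ S.V) :
    Fin (p + 1) → Module.End ℂ (S.V × R) :=
  Fin.snoc (α := fun _ => Module.End ℂ (S.V × R)) (fun i => (S.proj i).prodMap 0)
    (LinearMap.prodMap 0 LinearMap.id)

theorem extProj_complete (S : OkuboSystem.{u} p) (R : Submodule ℂ S.V) :
    CompleteOrthogonalIdempotents (S.extProj R) where
  idem i := by
    refine Fin.lastCases ?_ (fun i => ?_) i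
    · ext <;> simp [extProj]
    · have h := S.complete.idem i
      ext v <;> simp [extProj]
      exact LinearMap.congr_fun h v
  ortho i k hik := by
    revert hik
    refine Fin.lastCases ?_ (fun i => ?_) i <;> refine Fin.lastCases ?_ (fun k => ?_) k
    · intro h; exact absurd rfl h
    · intro _; ext <;> simp [extProj]
    · intro _; ext <;> simp [extProj]
    · intro hik
      have h := S.complete.ortho (i := i) (j := k) (fun e => hik (by rw [e]))
      ext v <;> simp [extProj]
      exact LinearMap.congr_fun h v
  complete := by
    have h := S.complete.complete
    rw [Fin.sum_univ_castSucc]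
    ext v
    · have h' := LinearMap.congr_fun h v
      simpa [extProj, LinearMap.sum_apply, Prod.fst_sum] using h'
    · simp [extProj, LinearMap.sum_apply, Prod.snd_sum]
    · simp [extProj, LinearMap.sum_apply]
    · simp [extProj, LinearMap.sum_apply, Prod.snd_sum]

/-- The extending operation `E^p_{ρ₁,ρ₂}`: on `V ⊕ Im (A - ρ₁)(A - ρ₂)`, the second summand being
the block of the new point `t_{p+1}`, take the matrix
`( A , I ; -(A - ρ₁)(A - ρ₂) , ρ₁ + ρ₂ - A )`. -/
def extend (ρ₁ ρ₂ : ℂ) (S : OkuboSystem.{u} p) : OkuboSystem.{u} (p + 1) where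
  V := S.V × LinearMap.range (S.quad ρ₁ ρ₂)
  proj := S.extProj (LinearMap.range (S.quad ρ₁ ρ₂))
  complete := S.extProj_complete _
  A := LinearMap.prod
    (S.A ∘ₗ LinearMap.fst ℂ _ _ +
      (LinearMap.range (S.quad ρ₁ ρ₂)).subtype ∘ₗ LinearMap.snd ℂ _ _)
    (-((S.quad ρ₁ ρ₂).rangeRestrict ∘ₗ LinearMap.fst ℂ _ _) +
      ((ρ₁ + ρ₂) • LinearMap.id - S.A.restrict (S.A_mem_range_quad ρ₁ ρ₂)) ∘ₗ
        LinearMap.snd ℂ _ _)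

/-- The conditions under which the extending operation is applied: the system is linearly
irreducible with `A` of full rank and the parameters are non-zero. -/
def ExtendDefined (ρ₁ ρ₂ : ℂ) (S : OkuboSystem.{u} p) : Prop :=
  S.IsLinIrred ∧ IsUnit S.A ∧ ρ₁ ≠ 0 ∧ ρ₂ ≠ 0

/-- `T_σ`: permutation of the blocks. -/
def permute (σ : Equiv.Perm (Fin p)) (S : OkuboSystem.{u} p) : OkuboSystem.{u} p where
  V := S.V
  proj i := S.proj (σ i)
  complete := CompleteOrthogonalIdempotents.equiv σ |>.2 S.complete
  A := S.A

theorem proj_proj (S : OkuboSystem.{u} p) (i : Fin p) (v : S.V) :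
    S.proj i (S.proj i v) = S.proj i v :=
  LinearMap.congr_fun (S.complete.idem i) v

theorem proj_proj_of_ne (S : OkuboSystem.{u} p) {i k : Fin p} (h : i ≠ k) (v : S.V) :
    S.proj i (S.proj k v) = 0 :=
  LinearMap.congr_fun (S.complete.ortho h) v

/-- The compression to the blocks `1, …, p`, whose sum is the kernel of the last projection. -/
def compress (S : OkuboSystem.{u} (p + 1)) (f : Module.End ℂ S.V) :
    Module.End ℂ (LinearMap.ker (S.proj (Fin.last p))) :=
  ((1 - S.proj (Fin.last p)) * f).restrict (p := LinearMap.ker (S.proj (Fin.last p)))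
    (q := LinearMap.ker (S.proj (Fin.last p)))
    (fun v _ => by simp [proj_proj])

theorem compress_proj_apply (S : OkuboSystem.{u} (p + 1)) (i : Fin p)
    (v : LinearMap.ker (S.proj (Fin.last p))) :
    (S.compress (S.proj i.castSucc) v : S.V) = S.proj i.castSucc v := by
  simp [compress, proj_proj_of_ne S (Fin.castSucc_lt_last i).ne']

theorem compress_complete (S : OkuboSystem.{u} (p + 1)) :
    CompleteOrthogonalIdempotents fun i : Fin p => S.compress (S.proj i.castSucc) where
  idem i := by
    refine LinearMap.ext fun v => Subtype.ext ?_
    simp [compress_proj_apply, proj_proj]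
  ortho i k hik := by
    refine LinearMap.ext fun v => Subtype.ext ?_
    have h : i.castSucc ≠ k.castSucc := fun e => hik (Fin.castSucc_injective p e)
    simp [compress_proj_apply, proj_proj_of_ne S h]
  complete := by
    refine LinearMap.ext fun v => Subtype.ext ?_
    have h := LinearMap.congr_fun S.complete.complete (v : S.V)
    rw [Fin.sum_univ_castSucc] at h
    have hv : S.proj (Fin.last p) v = 0 := v.2
    simpa [LinearMap.sum_apply, compress_proj_apply, hv] using h

/-- The operation `R^{p+1}`: delete the last block row and the last block column of `A`. -/
def restrictLast (S : OkuboSystem.{u} (p + 1)) : OkuboSystem.{u} p where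
  V := LinearMap.ker (S.proj (Fin.last p))
  proj i := S.compress (S.proj i.castSucc)
  complete := S.compress_complete
  A := S.compress S.A

/-- The diagonal block `A_{ii}`. -/
def diagBlock (S : OkuboSystem.{u} p) (i : Fin p) :
    Module.End ℂ (LinearMap.range (S.proj i)) :=
  (S.proj i * S.A).restrict (fun v _ => ⟨S.A v, rfl⟩)

/-- The conditions under which `R^{p+1}` is defined: the system is linearly irreducible,
`(A - μ₁)(A - μ₂) = 0`, and `μ₁ + μ₂` is not an eigenvalue of the last diagonal block. -/
def RestrictLastDefined (S : OkuboSystem.{u} (p + 1)) : Prop :=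
  S.IsLinIrred ∧ ∃ μ₁ μ₂ : ℂ, S.quad μ₁ μ₂ = 0 ∧
    ¬ (S.diagBlock (Fin.last p)).HasEigenvalue (μ₁ + μ₂)

/-- `R^{p+1}_j = R^{p+1} ∘ T_{(j,p+1)}`. -/
def restrict (j : Fin p) (S : OkuboSystem.{u} (p + 1)) : OkuboSystem.{u} p :=
  (S.permute (Equiv.swap j.castSucc (Fin.last p))).restrictLast

/-- `R^{p+1}_j` is defined at `S`. -/
def RestrictDefined (j : Fin p) (S : OkuboSystem.{u} (p + 1)) : Prop :=
  (S.permute (Equiv.swap j.castSucc (Fin.last p))).RestrictLastDefined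

end OkuboSystem

/-! Middle convolution of a system of Okubo normal form is a factorization of a shift of `A`. For
invertible `A`, the space `U` of `mc_{-ρ₁}(𝐀)` is a copy of `Im (A - ρ₁)`: one has `A = ρ₁ + α b`
with `b : V → U` surjective and `α : U → V` injective, and the residues on `U` are `b P_i α`
(`exists_mc_factor`). Conversely, if `A = lam + β ψ`, then `(P_i A)` is `mc_lam` of the tuple `ψ P_i
β`, provided `lam ≠ 0`, `β` covers each block, `ψ` is injective on each block and `lam + ψ β` is
injective (`sim_mc_of_factor`).

Extending, shifting and restricting keeps the middle space `U` (`exists_factor_extendRestrict`).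
With `γ = (ρ₂ - ρ₁) - b α` one has `(A - ρ₁)(A - ρ₂) = -α γ b`, so the block `V_j` is replaced by `α
γ U`, and the new matrix is `(ρ₁ + ε) + β ψ` with `ψ P_i β = b P_i α` for `i ≠ j` and `ψ P_j β = γ`.
As `b α` is the sum of the residues on `U`, this is `T_{(j,∞)}` followed by an addition, which is
part 1. A second round gives the `j`-th entry `(ρ₂ + ρ₃) - ψ β`. Since `ψ β = (ρ₂ - ρ₁) - b P_j α`,
this equals `b P_j α + (ρ₁ + ρ₃)`: the two swaps with infinity cancel, which is part 2.

The side conditions come from irreducibility and rank at least 2, or exclude finitely many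
eigenvalues. -/

namespace ResidueTuple

/-! ### Middle convolutions and factorizations of `A - lam` -/

variable {p : ℕ}

theorem mem_convK {B : ResidueTuple.{u} p} {w : Fin p → B.V} :
    w ∈ convK B ↔ ∀ i, B.mat i (w i) = 0 := by
  simp [convK, Submodule.mem_pi]

theorem mem_convL {lam : ℂ} {B : ResidueTuple.{u} p} {w : Fin p → B.V} :
    w ∈ convL lam B ↔ ∀ j, ∑ i, B.mat i (w i) + lam • w j = 0 := by
  have h : (∑ k, conv lam B k) w = fun j => ∑ i, B.mat i (w i) + lam • w j := by
    rw [LinearMap.sum_apply]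
    simp only [conv_apply]
    exact Finset.univ_sum_single (fun j => ∑ i, B.mat i (w i) + lam • w j)
  rw [convL, LinearMap.mem_ker, h, funext_iff]
  rfl

theorem Sim.symm {B C : ResidueTuple.{u} p} (h : B.Sim C) : C.Sim B := by
  obtain ⟨g, hg⟩ := h
  refine ⟨g.symm, fun i v => ?_⟩
  rw [LinearEquiv.symm_apply_eq, hg, LinearEquiv.apply_symm_apply]

theorem mc_sim_of_surjective {lam : ℂ} {C D : ResidueTuple.{u} p}
    (Φ : (Fin p → C.V) →ₗ[ℂ] D.V) (hΦ : Function.Surjective Φ)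
    (hker : LinearMap.ker Φ = convK C ⊔ convL lam C)
    (hcomm : ∀ i w, Φ (conv lam C i w) = D.mat i (Φ w)) : (C.mc lam).Sim D := by
  refine ⟨(Submodule.quotEquivOfEq _ _ hker.symm).trans
    (Φ.quotKerEquivOfSurjective hΦ), fun i v => ?_⟩
  obtain ⟨w, rfl⟩ := Submodule.Quotient.mk_surjective _ v
  exact hcomm i w

section Blocks

variable {V : Type u} [AddCommGroup V] [Module ℂ V] {Q : Fin p → Module.End ℂ V}

theorem sum_proj_apply (hQ : CompleteOrthogonalIdempotents Q) (v : V) : ∑ i, Q i v = v := by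
  have h := LinearMap.congr_fun hQ.complete v
  simpa [LinearMap.sum_apply] using h

theorem proj_sum_proj (hQ : CompleteOrthogonalIdempotents Q) (f : Fin p → V) (k : Fin p) :
    Q k (∑ i, Q i (f i)) = Q k (f k) := by
  rw [map_sum, Finset.sum_eq_single k]
  · exact LinearMap.congr_fun (hQ.idem k) _
  · intro i _ hi
    exact LinearMap.congr_fun (hQ.ortho hi.symm) _
  · simp

end Blocks

/-- If `A = lam + β ψ` with blocks `Q_i`, the tuple `Q_i A` is the middle convolution of the
tuple `ψ Q_i β`. -/
theorem sim_mc_of_factor {lam : ℂ} (hlam : lam ≠ 0) (C D : ResidueTuple.{u} p)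
    {Q : Fin p → Module.End ℂ D.V} (hQ : CompleteOrthogonalIdempotents Q)
    (ψ : D.V →ₗ[ℂ] C.V) (β : C.V →ₗ[ℂ] D.V)
    (hD : ∀ i x, D.mat i x = Q i (lam • x + β (ψ x)))
    (hC : ∀ i u, C.mat i u = ψ (Q i (β u)))
    (hsurj : ∀ i x, ∃ u, Q i (β u) = Q i x)
    (hinj : ∀ i x, ψ (Q i x) = 0 → Q i x = 0)
    (hne : ∀ u, lam • u + ψ (β u) = 0 → u = 0) : D.Sim (C.mc lam) := by
  let Φ : (Fin p → C.V) →ₗ[ℂ] D.V := ∑ i, Q i ∘ₗ β ∘ₗ LinearMap.proj i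
  have hΦ (w) : Φ w = ∑ i, Q i (β (w i)) := by simp [Φ, LinearMap.sum_apply]
  have hψΦ (w) : ψ (Φ w) = ∑ i, C.mat i (w i) := by simp [hΦ, hC]
  refine Sim.symm (mc_sim_of_surjective Φ ?_ ?_ ?_)
  · intro x
    choose u hu using fun i => hsurj i x
    exact ⟨u, by rw [hΦ, Finset.sum_congr rfl fun i _ => hu i, sum_proj_apply hQ]⟩
  -- The kernel of `Φ` is exactly `𝒦`: block projections separate the summands, and `ψ` is injective
  -- on blocks. The space `ℒ` vanishes: its elements are constant tuples because `lam ≠ 0`, and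
  -- their common entry is killed by `lam + ψ β`.
  · refine le_antisymm (fun w hw => Submodule.mem_sup_left ?_) (sup_le ?_ ?_)
    · rw [LinearMap.mem_ker, hΦ] at hw
      refine mem_convK.2 fun i => ?_
      rw [hC, ← proj_sum_proj hQ (fun i => β (w i)), hw, map_zero, map_zero]
    · intro w hw
      rw [LinearMap.mem_ker, hΦ]
      refine Finset.sum_eq_zero fun i _ => hinj _ _ ?_
      rw [← hC]
      exact mem_convK.1 hw i
    · intro w hw
      rw [mem_convL] at hw
      have hw0 : ∀ k, w k = 0 := by
        intro k
        have hk : ∀ i, w i = w k := fun i => by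
          have := (hw i).trans (hw k).symm
          exact (smul_right_injective _ hlam) (add_left_cancel this)
        have h1 := hw k
        rw [← hψΦ, hΦ] at h1
        simp only [hk, sum_proj_apply hQ] at h1
        exact hne _ (by rw [add_comm]; exact h1)
      rw [LinearMap.mem_ker, hΦ]
      simp [hw0]
  · intro i w
    have h1 : Φ (conv lam C i w) = Q i (β (ψ (Φ w) + lam • w i)) := by
      rw [hΦ, Finset.sum_eq_single i, conv_apply, Pi.single_eq_same, hψΦ]
      · intro k _ hk
        rw [conv_apply, Pi.single_eq_of_ne hk]
        simp
      · simp
    have h2 : Q i (Φ w) = Q i (β (w i)) := by rw [hΦ, proj_sum_proj hQ]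
    simp only [h1, hD, map_add, map_smul, h2]
    rw [add_comm]

/-- If `B_i = Q_i A` with blocks `Q_i` and invertible `A`, the middle convolution `mc_{-lam}`
comes from a factorization `A = lam + α b` through its space. -/
theorem exists_mc_factor {lam : ℂ} (hlam : lam ≠ 0) (B : ResidueTuple.{u} p)
    {Q : Fin p → Module.End ℂ B.V} (hQ : CompleteOrthogonalIdempotents Q)
    {A : Module.End ℂ B.V} (hA : IsUnit A) (hB : ∀ i x, B.mat i x = Q i (A x)) :
    ∃ (α : ((Fin p → B.V) ⧸ (convK B ⊔ convL (-lam) B)) →ₗ[ℂ] B.V)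
      (b : B.V →ₗ[ℂ] ((Fin p → B.V) ⧸ (convK B ⊔ convL (-lam) B))),
      Function.Injective α ∧ Function.Surjective b ∧ (∀ v, A v = lam • v + α (b v)) ∧
      ∀ i w, Submodule.Quotient.mk (conv (-lam) B i w) =
        b (Q i (α (Submodule.Quotient.mk w))) := by
  obtain ⟨Ai, hAi⟩ := hA.exists_right_inv
  have hAAi (v) : A (Ai v) = v := LinearMap.congr_fun hAi v
  set KL := convK B ⊔ convL (-lam) B with hKL
  let Φ : (Fin p → B.V) →ₗ[ℂ] B.V := ∑ i, Q i ∘ₗ A ∘ₗ LinearMap.proj i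
  have hΦ (w) : Φ w = ∑ i, Q i (A (w i)) := by simp [Φ, LinearMap.sum_apply]
  have hΦB (w) : ∑ i, B.mat i (w i) = Φ w := by simp [hΦ, hB]
  have hQΦ (i w) : Q i (Φ w) = Q i (A (w i)) := by rw [hΦ, proj_sum_proj hQ]
  have hΦc (v) : Φ (fun _ => v) = A v := by rw [hΦ, sum_proj_apply hQ]
  let N : Module.End ℂ B.V := A - lam • 1
  have hN (v) : N v = A v - lam • v := rfl
  have hkerΦ : LinearMap.ker Φ ≤ KL := by
    intro w hw
    refine Submodule.mem_sup_left (mem_convK.2 fun i => ?_)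
    rw [hB, ← hQΦ, LinearMap.mem_ker.1 hw, map_zero]
  -- If `Φ w` is an eigenvector for `lam`, the constant tuple `lam⁻¹ Φ w` lies in `ℒ` and has the
  -- same image under `Φ` as `w`, so the difference lies in `𝒦`. Hence `N ∘ Φ` identifies the
  -- quotient with `Im (A - lam)`.
  have hker : LinearMap.ker (N ∘ₗ Φ) = KL := by
    refine le_antisymm (fun w hw => ?_) (sup_le ?_ ?_)
    · replace hw : A (Φ w) = lam • Φ w := sub_eq_zero.1 hw
      have hc : (fun _ => lam⁻¹ • Φ w) ∈ KL := by
        refine Submodule.mem_sup_right (mem_convL.2 fun j => ?_)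
        rw [hΦB, hΦc, map_smul, hw, smul_smul, smul_smul]
        simp [hlam]
      have hd : w - (fun _ => lam⁻¹ • Φ w) ∈ KL := by
        refine hkerΦ ?_
        rw [LinearMap.mem_ker, map_sub, hΦc, map_smul, hw, smul_smul, inv_mul_cancel₀ hlam,
          one_smul, sub_self]
      have := KL.add_mem hd hc
      rwa [sub_add_cancel] at this
    · intro w hw
      have : Φ w = 0 := by
        rw [← hΦB]
        exact Finset.sum_eq_zero fun i _ => mem_convK.1 hw i
      rw [LinearMap.mem_ker, LinearMap.comp_apply, this, map_zero]
    · intro w hw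
      rw [mem_convL] at hw
      have hw' (j) : Φ w = lam • w j := by
        have := hw j
        rwa [hΦB, neg_smul, add_neg_eq_zero] at this
      rw [LinearMap.mem_ker, LinearMap.comp_apply, hN, sub_eq_zero]
      rw [← sum_proj_apply hQ (A (Φ w))]
      calc ∑ i, Q i (A (Φ w)) = ∑ i, Q i (A (lam • w i)) :=
            Finset.sum_congr rfl fun i _ => by rw [← hw' i]
        _ = lam • Φ w := by simp only [hΦ, map_smul, Finset.smul_sum]
  let α : ((Fin p → B.V) ⧸ KL) →ₗ[ℂ] B.V := KL.liftQ (N ∘ₗ Φ) hker.ge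
  have hα (w) : α (Submodule.Quotient.mk w) = N (Φ w) := rfl
  -- The constant tuple with entry `A⁻¹ v` is a preimage of `v` under `Φ`; this gives `α b = N`.
  let b : B.V →ₗ[ℂ] ((Fin p → B.V) ⧸ KL) := KL.mkQ ∘ₗ LinearMap.pi (fun _ => Ai)
  have hb (v) : b v = Submodule.Quotient.mk (fun _ => Ai v) := rfl
  have hαb (v) : α (b v) = N v := by rw [hb, hα, hΦc, hAAi]
  have hαi : Function.Injective α := by
    rw [← LinearMap.ker_eq_bot]
    exact Submodule.ker_liftQ_eq_bot _ _ _ hker.le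
  refine ⟨α, b, hαi, ?_, ?_, ?_⟩
  · intro u
    obtain ⟨w, rfl⟩ := Submodule.Quotient.mk_surjective _ u
    refine ⟨Φ w, ?_⟩
    rw [hb]
    refine (Submodule.Quotient.eq KL).2 (hkerΦ ?_)
    rw [LinearMap.mem_ker, map_sub, hΦc, hAAi, sub_self]
  · intro v
    rw [hαb, hN, add_sub_cancel]
  · intro i w
    refine hαi ?_
    rw [hαb, hα, hα]
    congr 1
    rw [hΦ, Finset.sum_eq_single i, conv_apply, Pi.single_eq_same, hN, hΦB, map_add, map_add,
      map_sub, map_smul, map_smul, map_smul, neg_smul, ← sub_eq_add_neg, hQΦ]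
    · intro k _ hk
      rw [conv_apply, Pi.single_eq_of_ne hk]
      simp
    · simp

end ResidueTuple

/-! ### The factorization carried through extension, shift and restriction -/

namespace OkuboSystem

variable {p : ℕ}

theorem exists_mc_factor {lam : ℂ} (hlam : lam ≠ 0) (S : OkuboSystem.{u} p) (hA : IsUnit S.A) :
    ∃ (α : (S.toTuple.mc (-lam)).V →ₗ[ℂ] S.V) (b : S.V →ₗ[ℂ] (S.toTuple.mc (-lam)).V),
      Function.Injective α ∧ Function.Surjective b ∧ (∀ v, S.A v = lam • v + α (b v)) ∧
      ∀ i u, (S.toTuple.mc (-lam)).mat i u = b (S.proj i (α u)) := by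
  obtain ⟨α, b, hα, hb, hab, h⟩ :=
    ResidueTuple.exists_mc_factor hlam S.toTuple S.complete hA (fun _ _ => rfl)
  refine ⟨α, b, hα, hb, hab, fun i u => ?_⟩
  obtain ⟨w, rfl⟩ := Submodule.Quotient.mk_surjective _ u
  exact h i w

/-- The restriction of the extension, `R^{p+1}_j ∘ E_ε ∘ E^p_{σ₁,σ₂}`. -/
noncomputable abbrev extendRestrict (j : Fin p) (σ₁ σ₂ ε : ℂ) (S : OkuboSystem.{u} p) :
    OkuboSystem.{u} p :=
  ((S.extend σ₁ σ₂).euler ε).restrict j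

section Coordinates

variable (j : Fin p) (σ₁ σ₂ ε : ℂ) (S : OkuboSystem.{u} p)

/-- The component in the blocks of `S` different from the `j`-th one. -/
noncomputable def erFst : (S.extendRestrict j σ₁ σ₂ ε).V →ₗ[ℂ] S.V :=
  LinearMap.fst ℂ S.V (LinearMap.range (S.quad σ₁ σ₂)) ∘ₗ
    Submodule.subtype (LinearMap.ker
      (S.extProj (LinearMap.range (S.quad σ₁ σ₂))
        (Equiv.swap j.castSucc (Fin.last p) (Fin.last p))))

/-- The component in the `j`-th block `Im (A - σ₁)(A - σ₂)`. -/
noncomputable def erSnd :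
    (S.extendRestrict j σ₁ σ₂ ε).V →ₗ[ℂ] LinearMap.range (S.quad σ₁ σ₂) :=
  LinearMap.snd ℂ S.V (LinearMap.range (S.quad σ₁ σ₂)) ∘ₗ
    Submodule.subtype (LinearMap.ker
      (S.extProj (LinearMap.range (S.quad σ₁ σ₂))
        (Equiv.swap j.castSucc (Fin.last p) (Fin.last p))))

theorem extProj_swap_last (R : Submodule ℂ S.V) :
    S.extProj R (Equiv.swap j.castSucc (Fin.last p) (Fin.last p)) = (S.proj j).prodMap 0 := by
  simp [extProj]

theorem extProj_swap_of_ne (R : Submodule ℂ S.V) {i : Fin p} (h : i ≠ j) :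
    S.extProj R (Equiv.swap j.castSucc (Fin.last p) i.castSucc) = (S.proj i).prodMap 0 := by
  rw [Equiv.swap_apply_of_ne_of_ne (fun e => h (Fin.castSucc_injective p e))
    (Fin.castSucc_lt_last i).ne]
  simp [extProj]

theorem extProj_swap_self (R : Submodule ℂ S.V) :
    S.extProj R (Equiv.swap j.castSucc (Fin.last p) j.castSucc) =
      LinearMap.prodMap 0 LinearMap.id := by
  simp [extProj]

/-- The element with given components. -/
noncomputable def erMk :
    S.V × LinearMap.range (S.quad σ₁ σ₂) →ₗ[ℂ] (S.extendRestrict j σ₁ σ₂ ε).V :=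
  LinearMap.codRestrict (LinearMap.ker
      (S.extProj (LinearMap.range (S.quad σ₁ σ₂))
        (Equiv.swap j.castSucc (Fin.last p) (Fin.last p))))
    (LinearMap.prodMap (1 - S.proj j) LinearMap.id) (fun x => by
      rw [extProj_swap_last, LinearMap.mem_ker]
      simp [proj_proj])

variable {j σ₁ σ₂ ε S}

@[simp] theorem erFst_erMk (x) : S.erFst j σ₁ σ₂ ε (S.erMk j σ₁ σ₂ ε x) =
    x.1 - S.proj j x.1 := rfl

@[simp] theorem erSnd_erMk (x) : S.erSnd j σ₁ σ₂ ε (S.erMk j σ₁ σ₂ ε x) = x.2 := rfl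

theorem er_ext {x y : (S.extendRestrict j σ₁ σ₂ ε).V}
    (h₁ : S.erFst j σ₁ σ₂ ε x = S.erFst j σ₁ σ₂ ε y)
    (h₂ : S.erSnd j σ₁ σ₂ ε x = S.erSnd j σ₁ σ₂ ε y) : x = y :=
  Subtype.ext (Prod.ext h₁ h₂)

theorem proj_erFst (x) : S.proj j (S.erFst j σ₁ σ₂ ε x) = 0 := by
  have h := x.2
  have h' := LinearMap.congr_fun (extProj_swap_last j S (LinearMap.range (S.quad σ₁ σ₂)))
    (x.1 : S.V × LinearMap.range (S.quad σ₁ σ₂))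
  exact congrArg Prod.fst (h'.symm.trans (LinearMap.mem_ker.1 h))

theorem coe_restrict_proj (i : Fin p) (x : (S.extendRestrict j σ₁ σ₂ ε).V) :
    (((S.extendRestrict j σ₁ σ₂ ε).proj i x).1 : S.V × LinearMap.range (S.quad σ₁ σ₂)) =
      S.extProj (LinearMap.range (S.quad σ₁ σ₂)) (Equiv.swap j.castSucc (Fin.last p) i.castSucc)
        (x.1 : S.V × LinearMap.range (S.quad σ₁ σ₂)) :=
  compress_proj_apply
    (((S.extend σ₁ σ₂).euler ε).permute (Equiv.swap j.castSucc (Fin.last p))) i x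

theorem erFst_proj_of_ne {i : Fin p} (h : i ≠ j) (x) :
    S.erFst j σ₁ σ₂ ε ((S.extendRestrict j σ₁ σ₂ ε).proj i x) =
      S.proj i (S.erFst j σ₁ σ₂ ε x) := by
  have h' := coe_restrict_proj i x
  rw [extProj_swap_of_ne j S _ h] at h'
  exact congrArg Prod.fst h'

theorem erSnd_proj_of_ne {i : Fin p} (h : i ≠ j) (x) :
    S.erSnd j σ₁ σ₂ ε ((S.extendRestrict j σ₁ σ₂ ε).proj i x) = 0 := by
  have h' := coe_restrict_proj i x
  rw [extProj_swap_of_ne j S _ h] at h'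
  exact congrArg Prod.snd h'

theorem erFst_proj_self (x) :
    S.erFst j σ₁ σ₂ ε ((S.extendRestrict j σ₁ σ₂ ε).proj j x) = 0 := by
  have h' := coe_restrict_proj j x
  rw [extProj_swap_self] at h'
  exact congrArg Prod.fst h'

theorem erSnd_proj_self (x) :
    S.erSnd j σ₁ σ₂ ε ((S.extendRestrict j σ₁ σ₂ ε).proj j x) = S.erSnd j σ₁ σ₂ ε x := by
  have h' := coe_restrict_proj j x
  rw [extProj_swap_self] at h'
  have h2 := congrArg Prod.snd h'
  exact h2

theorem coe_restrict_A (x : (S.extendRestrict j σ₁ σ₂ ε).V) :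
    (((S.extendRestrict j σ₁ σ₂ ε).A x).1 : S.V × LinearMap.range (S.quad σ₁ σ₂)) =
      (LinearMap.id - S.extProj (LinearMap.range (S.quad σ₁ σ₂))
        (Equiv.swap j.castSucc (Fin.last p) (Fin.last p)) :
          Module.End ℂ (S.V × LinearMap.range (S.quad σ₁ σ₂)))
        (((S.extend σ₁ σ₂).euler ε).A x.1) := rfl

theorem erFst_A (x) :
    S.erFst j σ₁ σ₂ ε ((S.extendRestrict j σ₁ σ₂ ε).A x) =
      (S.A (S.erFst j σ₁ σ₂ ε x) + S.erSnd j σ₁ σ₂ ε x + ε • S.erFst j σ₁ σ₂ ε x) -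
      S.proj j (S.A (S.erFst j σ₁ σ₂ ε x) + S.erSnd j σ₁ σ₂ ε x + ε • S.erFst j σ₁ σ₂ ε x) := by
  have h' := coe_restrict_A x
  rw [extProj_swap_last] at h'
  exact congrArg Prod.fst h'

theorem erSnd_A (x) :
    (S.erSnd j σ₁ σ₂ ε ((S.extendRestrict j σ₁ σ₂ ε).A x) : S.V) =
      -S.quad σ₁ σ₂ (S.erFst j σ₁ σ₂ ε x) +
        ((σ₁ + σ₂) • (S.erSnd j σ₁ σ₂ ε x : S.V) - S.A (S.erSnd j σ₁ σ₂ ε x)) +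
        ε • (S.erSnd j σ₁ σ₂ ε x : S.V) := by
  have h' := coe_restrict_A x
  rw [extProj_swap_last] at h'
  have h2 := congrArg Prod.snd h'
  refine (congrArg Subtype.val h2).trans ?_
  exact sub_zero _

theorem quad_apply (v : S.V) :
    S.quad σ₁ σ₂ v = S.A (S.A v - σ₂ • v) - σ₁ • (S.A v - σ₂ • v) := rfl

end Coordinates

/-- A factorization `A = σ₁ + α b` induces one of the restriction of the extension. -/
theorem exists_factor_extendRestrict (j : Fin p) (σ₁ σ₂ ε : ℂ) (S : OkuboSystem.{u} p)
    {U : Type u} [AddCommGroup U] [Module ℂ U] (α : U →ₗ[ℂ] S.V) (b : S.V →ₗ[ℂ] U)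
    (hα : Function.Injective α) (hb : Function.Surjective b)
    (hA : ∀ v, S.A v = σ₁ • v + α (b v))
    (hs : ∀ i, i ≠ j → ∀ v, ∃ u, S.proj i (α u) = S.proj i v)
    (hi : ∀ i, i ≠ j → ∀ v, b (S.proj i v) = 0 → S.proj i v = 0) :
    ∃ (β : U →ₗ[ℂ] (S.extendRestrict j σ₁ σ₂ ε).V) (ψ : (S.extendRestrict j σ₁ σ₂ ε).V →ₗ[ℂ] U),
      (∀ x, (S.extendRestrict j σ₁ σ₂ ε).A x = (σ₁ + ε) • x + β (ψ x)) ∧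
      (∀ i, i ≠ j → ∀ u, ψ ((S.extendRestrict j σ₁ σ₂ ε).proj i (β u)) = b (S.proj i (α u))) ∧
      (∀ u, ψ ((S.extendRestrict j σ₁ σ₂ ε).proj j (β u)) = (σ₂ - σ₁) • u - b (α u)) ∧
      (∀ i x, ∃ u, (S.extendRestrict j σ₁ σ₂ ε).proj i (β u) =
        (S.extendRestrict j σ₁ σ₂ ε).proj i x) ∧
      (∀ i x, ψ ((S.extendRestrict j σ₁ σ₂ ε).proj i x) = 0 →
        (S.extendRestrict j σ₁ σ₂ ε).proj i x = 0) ∧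
      ((∀ v, S.proj j v = v → S.A v = σ₂ • v → v = 0) → Function.Injective β) ∧
      ((∀ v, ∃ w, S.proj j (S.A w - σ₂ • w) = S.proj j v) → Function.Surjective ψ) := by
  obtain ⟨c, hc⟩ := α.exists_leftInverse_of_injective (LinearMap.ker_eq_bot.2 hα)
  have hcα (u) : c (α u) = u := LinearMap.congr_fun hc u
  let γ : U →ₗ[ℂ] U := (σ₂ - σ₁) • LinearMap.id - b ∘ₗ α
  have hγ (u) : γ u = (σ₂ - σ₁) • u - b (α u) := rfl
  -- `(A - σ₁)(A - σ₂) = α b (α b + σ₁ - σ₂)`. Since `b` is onto, the new block is `α γ U`.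
  have hq (v) : S.quad σ₁ σ₂ v = -α (γ (b v)) := by
    rw [quad_apply, hA (S.A v - _), hγ, hA v]
    simp only [map_add, map_sub, map_smul]
    module
  have hqm (u) : (α ∘ₗ γ) u ∈ LinearMap.range (S.quad σ₁ σ₂) := by
    obtain ⟨v, rfl⟩ := hb u
    exact ⟨-v, by rw [map_neg, hq]; simp⟩
  have hr (r : LinearMap.range (S.quad σ₁ σ₂)) : ∃ u, (r : S.V) = α (γ u) := by
    obtain ⟨_, v, rfl⟩ := r
    exact ⟨-b v, by rw [map_neg, map_neg]; exact hq v⟩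
  -- Off the block `j` the old maps are kept. On the new block `β` is `α γ`, and `ψ` undoes `α` by
  -- its left inverse `c`, so that their composite there is `γ`.
  let β : U →ₗ[ℂ] (S.extendRestrict j σ₁ σ₂ ε).V :=
    S.erMk j σ₁ σ₂ ε ∘ₗ LinearMap.prod α (LinearMap.codRestrict _ (α ∘ₗ γ) hqm)
  let ψ : (S.extendRestrict j σ₁ σ₂ ε).V →ₗ[ℂ] U :=
    b ∘ₗ S.erFst j σ₁ σ₂ ε + c ∘ₗ Submodule.subtype _ ∘ₗ S.erSnd j σ₁ σ₂ ε
  have hψ (x) : ψ x = b (S.erFst j σ₁ σ₂ ε x) + c (S.erSnd j σ₁ σ₂ ε x) := rfl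
  have hβ₁ (u) : S.erFst j σ₁ σ₂ ε (β u) = α u - S.proj j (α u) := rfl
  have hβ₂ (u) : (S.erSnd j σ₁ σ₂ ε (β u) : S.V) = α (γ u) := rfl
  have hproj_ne {i} (h : i ≠ j) (x) : ψ ((S.extendRestrict j σ₁ σ₂ ε).proj i x) =
      b (S.proj i (S.erFst j σ₁ σ₂ ε x)) := by
    rw [hψ, erFst_proj_of_ne h, erSnd_proj_of_ne h]
    simp
  have hproj_self (x) : ψ ((S.extendRestrict j σ₁ σ₂ ε).proj j x) =
      c (S.erSnd j σ₁ σ₂ ε x) := by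
    rw [hψ, erFst_proj_self, erSnd_proj_self]
    simp
  have hβ_ne {i} (h : i ≠ j) (u) : S.proj i (S.erFst j σ₁ σ₂ ε (β u)) = S.proj i (α u) := by
    rw [hβ₁, map_sub, proj_proj_of_ne S h, sub_zero]
  refine ⟨β, ψ, fun x => ?_, fun i h u => ?_, fun u => ?_, fun i x => ?_, fun i x hx => ?_,
    fun h => ?_, fun h => ?_⟩
  · obtain ⟨u, hu⟩ := hr (S.erSnd j σ₁ σ₂ ε x)
    have h0 := S.proj_erFst x
    refine er_ext ?_ (Subtype.ext ?_)
    · rw [erFst_A, map_add (S.erFst j σ₁ σ₂ ε), map_smul (S.erFst j σ₁ σ₂ ε), hβ₁, hψ, hA, hu, hcα]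
      simp only [map_add, map_smul, h0]
      module
    · rw [erSnd_A, map_add (S.erSnd j σ₁ σ₂ ε), map_smul (S.erSnd j σ₁ σ₂ ε), Submodule.coe_add,
        Submodule.coe_smul, hβ₂, hψ, hu, hcα,
        hq, hA, map_add γ, map_add α, hγ (γ u)]
      simp only [map_sub, map_smul]
      module
  · rw [hproj_ne h, hβ_ne h]
  · rw [hproj_self, hβ₂, hcα, hγ]
  · by_cases h : i = j
    · subst h
      obtain ⟨u, hu⟩ := hr (S.erSnd i σ₁ σ₂ ε x)
      refine ⟨u, er_ext ?_ ?_⟩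
      · rw [erFst_proj_self, erFst_proj_self]
      · rw [erSnd_proj_self, erSnd_proj_self]
        exact Subtype.ext hu.symm
    · obtain ⟨u, hu⟩ := hs i h (S.erFst j σ₁ σ₂ ε x)
      refine ⟨u, er_ext ?_ ?_⟩
      · rw [erFst_proj_of_ne h, erFst_proj_of_ne h, hβ_ne h, hu]
      · rw [erSnd_proj_of_ne h, erSnd_proj_of_ne h]
  · by_cases h : i = j
    · subst h
      obtain ⟨u, hu⟩ := hr (S.erSnd i σ₁ σ₂ ε x)
      rw [hproj_self, hu, hcα] at hx
      refine er_ext ?_ ?_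
      · rw [erFst_proj_self, map_zero]
      · rw [erSnd_proj_self, map_zero]
        refine Subtype.ext ?_
        rw [hu, hx, map_zero]
        rfl
    · rw [hproj_ne h] at hx
      refine er_ext ?_ ?_
      · rw [erFst_proj_of_ne h, map_zero, hi i h _ hx]
      · rw [erSnd_proj_of_ne h, map_zero]
  · rw [← LinearMap.ker_eq_bot, LinearMap.ker_eq_bot']
    intro u hu
    -- A vector `u` killed by `β` has `α u` in `V_j`, and `γ u = 0` says that `α u` satisfies the
    -- eigenvalue equation for `σ₂`.
    have h1 : α u - S.proj j (α u) = 0 := by rw [← hβ₁, hu, map_zero]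
    have h2 : γ u = 0 := hα (by rw [← hβ₂, hu, map_zero, map_zero]; rfl)
    refine hα ((h (α u) (sub_eq_zero.1 h1).symm ?_).trans (map_zero α).symm)
    rw [hγ, sub_eq_zero] at h2
    rw [hA, ← h2, map_smul]
    module
  · intro u
    obtain ⟨v, rfl⟩ := hb u
    obtain ⟨w, hw⟩ := h v
    -- Subtracting `(A - σ₂) w` removes the `j`-th component of `v`. Since `b (A - σ₂) = -γ b`, the
    -- entry `α γ (-b w)` in the new block compensates the change in `b v`.
    refine ⟨S.erMk j σ₁ σ₂ ε (v - (S.A w - σ₂ • w), ⟨_, hqm (-b w)⟩), ?_⟩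
    have h' : S.proj j (v - (S.A w - σ₂ • w)) = 0 := by rw [map_sub, hw, sub_self]
    rw [hψ, erFst_erMk, erSnd_erMk, h', sub_zero]
    simp only [LinearMap.comp_apply, hcα]
    rw [hγ, hA]
    simp only [map_add, map_sub, map_smul, map_neg]
    module

/-- The only subspaces stable under `A` and all block projections are `0` and `V`. -/
def IsBlockIrred (S : OkuboSystem.{u} p) : Prop :=
  ∀ W : Submodule ℂ S.V, (∀ i, ∀ v ∈ W, S.proj i v ∈ W) → (∀ v ∈ W, S.A v ∈ W) → W = ⊥ ∨ W = ⊤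

/-! ### Irreducibility in terms of blocks, and its preservation -/

theorem sum_proj_apply (S : OkuboSystem.{u} p) (v : S.V) : ∑ i, S.proj i v = v :=
  ResidueTuple.sum_proj_apply S.complete v

theorem IsLinIrred.isBlockIrred {S : OkuboSystem.{u} p} (h : S.IsLinIrred) : S.IsBlockIrred :=
  fun W h₁ h₂ => h W fun i v hv => h₁ i _ (h₂ v hv)

/-- An injective `A` maps a finite dimensional stable subspace `W` onto itself, so stability under
all `P_i A` gives stability under all `P_i`. Block irreducibility is insensitive to scalar shifts of
`A`, which makes it the notion to propagate; linear irreducibility is recovered once `A` is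
injective. -/
theorem IsBlockIrred.isLinIrred {S : OkuboSystem.{u} p} (h : S.IsBlockIrred)
    (hA : Function.Injective S.A) : S.IsLinIrred := by
  suffices H : ∀ W : Submodule ℂ S.V, (∀ i, ∀ v ∈ W, S.proj i (S.A v) ∈ W) →
      W = ⊥ ∨ W = ⊤ from H
  intro W hW
  have hAW : ∀ v ∈ W, S.A v ∈ W := fun v hv => by
    rw [← S.sum_proj_apply (S.A v)]
    exact Submodule.sum_mem W fun i _ => hW i v hv
  refine h W (fun i w hw => ?_) hAW
  have hinj : Function.Injective (LinearMap.restrict (p := W) (q := W) S.A hAW) := fun x y hxy =>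
    Subtype.ext (hA (congrArg Subtype.val hxy))
  obtain ⟨v, hv⟩ := LinearMap.injective_iff_surjective.1 hinj ⟨w, hw⟩
  have : S.A v = w := congrArg Subtype.val hv
  rw [← this]
  exact hW i v v.2

theorem IsBlockIrred.euler {S : OkuboSystem.{u} p} (h : S.IsBlockIrred) (ε : ℂ) :
    (S.euler ε).IsBlockIrred := by
  intro W h₁ h₂
  refine h W h₁ fun v hv => ?_
  have h3 := W.sub_mem (h₂ v hv) (W.smul_mem ε hv)
  have h4 : (S.euler ε).A v = S.A v + ε • v := rfl
  rw [h4] at h3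
  exact (add_sub_cancel_right (S.A v) (ε • v)) ▸ h3

theorem IsBlockIrred.permute {S : OkuboSystem.{u} p} (h : S.IsBlockIrred)
    (σ : Equiv.Perm (Fin p)) : (S.permute σ).IsBlockIrred := by
  intro W h₁ h₂
  refine h W (fun i v hv => ?_) h₂
  have := h₁ (σ.symm i) v hv
  change S.proj (σ (σ.symm i)) v ∈ W at this
  rwa [Equiv.apply_symm_apply] at this

/-- A stable subspace splits along the two summands, and its part in `V` is stable for the original
system. If that part is zero, the injective upper right block kills the rest; if it is `V`, the
lower left block fills the new summand. -/
theorem IsBlockIrred.extend {S : OkuboSystem.{u} p} (h : S.IsBlockIrred) (σ₁ σ₂ : ℂ) :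
    (S.extend σ₁ σ₂).IsBlockIrred := by
  suffices H : ∀ W : Submodule ℂ (S.V × LinearMap.range (S.quad σ₁ σ₂)),
      (∀ i, ∀ x ∈ W, S.extProj (LinearMap.range (S.quad σ₁ σ₂)) i x ∈ W) →
      (∀ x ∈ W, ((S.A x.1 + x.2, -(S.quad σ₁ σ₂).rangeRestrict x.1 +
          ((σ₁ + σ₂) • x.2 - S.A.restrict (S.A_mem_range_quad σ₁ σ₂) x.2)) :
          S.V × LinearMap.range (S.quad σ₁ σ₂)) ∈ W) → W = ⊥ ∨ W = ⊤ from
    fun W h₁ h₂ => H W h₁ h₂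
  intro W h₁ h₂
  have hsnd : ∀ x ∈ W, ((0, x.2) : S.V × LinearMap.range (S.quad σ₁ σ₂)) ∈ W := fun x hx => by
    simpa [extProj] using h₁ (Fin.last p) x hx
  have hfst : ∀ x ∈ W, ((x.1, 0) : S.V × LinearMap.range (S.quad σ₁ σ₂)) ∈ W := fun x hx => by
    have h3 := W.sub_mem hx (hsnd x hx)
    have e : x - (0, x.2) = (x.1, 0) := Prod.ext (by simp) (by simp)
    rwa [e] at h3
  have h0 := h (W.comap (LinearMap.inl ℂ _ _)) (fun i v hv => by
      simpa [extProj] using h₁ i.castSucc _ hv)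
    (fun v hv => by simpa using hfst _ (h₂ _ hv))
  rcases h0 with h0 | h0
  · left
    have hz : ∀ v : S.V, ((v, 0) : S.V × LinearMap.range (S.quad σ₁ σ₂)) ∈ W → v = 0 :=
      fun v hv => by
        have : v ∈ W.comap (LinearMap.inl ℂ _ _) := hv
        rwa [h0, Submodule.mem_bot] at this
    refine (Submodule.eq_bot_iff W).2 fun x hx => Prod.ext (hz _ (hfst x hx)) (Subtype.ext ?_)
    have := hz _ (hfst _ (h₂ _ (hsnd x hx)))
    simpa using this
  · right
    have hv : ∀ v : S.V, ((v, 0) : S.V × LinearMap.range (S.quad σ₁ σ₂)) ∈ W := fun v => by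
      have : v ∈ W.comap (LinearMap.inl ℂ _ _) := by rw [h0]; trivial
      exact this
    refine (Submodule.eq_top_iff').2 fun x => ?_
    obtain ⟨v, ⟨_, w, rfl⟩⟩ := x
    have h3 := hsnd _ (h₂ _ (hv (-w)))
    have h4 := W.add_mem (hv v) h3
    refine (congrArg (· ∈ W) (Prod.ext ?_ (Subtype.ext ?_))).mp h4
    · simp
    · simp

theorem quad_eq_zero_apply {S : OkuboSystem.{u} p} {μ₁ μ₂ : ℂ} (h : S.quad μ₁ μ₂ = 0) (v : S.V) :
    S.A (S.A v) = (μ₁ + μ₂) • S.A v - (μ₁ * μ₂) • v := by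
  have h' : S.quad μ₁ μ₂ v = 0 := by rw [h]; rfl
  rw [quad_apply, map_sub, map_smul] at h'
  rw [← sub_eq_zero, ← h']
  module

theorem A_injective_of_quad {S : OkuboSystem.{u} p} {μ₁ μ₂ : ℂ} (h : S.quad μ₁ μ₂ = 0)
    (h₁ : μ₁ ≠ 0) (h₂ : μ₂ ≠ 0) : Function.Injective S.A := by
  rw [← LinearMap.ker_eq_bot, LinearMap.ker_eq_bot']
  intro v hv
  have := quad_eq_zero_apply h v
  rw [hv, map_zero, smul_zero, zero_sub, zero_eq_neg, smul_eq_zero] at this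
  exact this.resolve_left (mul_ne_zero h₁ h₂)

/-- This is Cayley–Hamilton for a 2 by 2 matrix over `ℂ[A]`: the trace is `σ₁ + σ₂` and the
determinant is `A (σ₁ + σ₂ - A) + (A - σ₁)(A - σ₂) = σ₁ σ₂`. -/
theorem quad_extend (S : OkuboSystem.{u} p) (σ₁ σ₂ : ℂ) : (S.extend σ₁ σ₂).quad σ₁ σ₂ = 0 := by
  suffices H : ∀ (v : S.V) (r : LinearMap.range (S.quad σ₁ σ₂)),
      (S.extend σ₁ σ₂).quad σ₁ σ₂ ((v, r) : S.V × LinearMap.range (S.quad σ₁ σ₂)) =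
        ((0, 0) : S.V × LinearMap.range (S.quad σ₁ σ₂)) from
    LinearMap.ext fun x => H x.1 x.2
  intro v r
  have h : ∀ (v : S.V) (r : LinearMap.range (S.quad σ₁ σ₂)) (μ : ℂ),
      ((S.extend σ₁ σ₂).A - μ • 1) ((v, r) : S.V × LinearMap.range (S.quad σ₁ σ₂)) =
      ((S.A v + r - μ • v, -(S.quad σ₁ σ₂).rangeRestrict v +
          ((σ₁ + σ₂) • r - S.A.restrict (S.A_mem_range_quad σ₁ σ₂) r) - μ • r) :
          S.V × LinearMap.range (S.quad σ₁ σ₂)) := fun _ _ _ => rfl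
  refine (congrArg ((S.extend σ₁ σ₂).A - σ₁ • (1 : Module.End ℂ (S.extend σ₁ σ₂).V))
    (h v r σ₂)).trans ((h _ _ σ₁).trans ?_)
  refine Prod.ext ?_ (Subtype.ext ?_)
  · simp [quad_apply]
    module
  · simp [quad_apply]
    module

theorem quad_euler (S : OkuboSystem.{u} p) (σ₁ σ₂ ε : ℂ) :
    (S.euler ε).quad (σ₁ + ε) (σ₂ + ε) = S.quad σ₁ σ₂ := by
  have h (σ : ℂ) : S.A + ε • (1 : Module.End ℂ S.V) - (σ + ε) • (1 : Module.End ℂ S.V) =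
      S.A - σ • 1 := by
    module
  exact congrArg₂ (fun f g : Module.End ℂ S.V => f * g) (h σ₁) (h σ₂)

theorem eulerDefined_of_quad {S : OkuboSystem.{u} p} {μ₁ μ₂ ε : ℂ} (h : S.quad μ₁ μ₂ = 0)
    (h₁ : μ₁ + ε ≠ 0) (h₂ : μ₂ + ε ≠ 0) : S.EulerDefined ε := by
  intro he
  obtain ⟨v, hv⟩ := he.exists_hasEigenvector
  have hv1 : S.A v = (-ε) • v := hv.apply_eq_smul
  have := quad_eq_zero_apply h v
  rw [hv1, map_smul, hv1, ← sub_eq_zero] at this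
  have h3 : ((μ₁ + ε) * (μ₂ + ε)) • v = 0 := by
    rw [← this]
    module
  exact hv.2 ((smul_eq_zero.1 h3).resolve_left (mul_ne_zero h₁ h₂))

/-- With `P` the last projection, a stable `W` of the restriction enlarges to `W + P A W`. The
quadratic relation makes this sum stable under `A`, since it expresses `A P A w` through `A w`, `w`
and `A` applied to the compressed `A w`. Projecting away the last block recovers `W`. -/
theorem IsBlockIrred.restrictLast {S : OkuboSystem.{u} (p + 1)} (h : S.IsBlockIrred)
    {μ₁ μ₂ : ℂ} (hq : S.quad μ₁ μ₂ = 0) : S.restrictLast.IsBlockIrred := by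
  suffices H : ∀ W : Submodule ℂ (LinearMap.ker (S.proj (Fin.last p))),
      (∀ i : Fin p, ∀ v ∈ W, S.compress (S.proj i.castSucc) v ∈ W) →
      (∀ v ∈ W, S.compress S.A v ∈ W) → W = ⊥ ∨ W = ⊤ from fun W h₁ h₂ => H W h₁ h₂
  intro W h₁ h₂
  have hPP (v) : S.proj (Fin.last p) (S.proj (Fin.last p) v) = S.proj (Fin.last p) v := S.proj_proj _ v
  have hPW (v : LinearMap.ker (S.proj (Fin.last p))) : S.proj (Fin.last p) v = 0 := v.2
  have hcA (v : LinearMap.ker (S.proj (Fin.last p))) : (S.compress S.A v : S.V) =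
      S.A v - S.proj (Fin.last p) (S.A v) := rfl
  let W₁ : Submodule ℂ S.V := W.map (Submodule.subtype _)
  let W₂ : Submodule ℂ S.V := W.map (S.proj (Fin.last p) ∘ₗ S.A ∘ₗ Submodule.subtype _)
  have m₁ {w} (hw : w ∈ W) : (w : S.V) ∈ W₁ ⊔ W₂ := Submodule.mem_sup_left ⟨w, hw, rfl⟩
  have m₂ {w : LinearMap.ker (S.proj (Fin.last p))} (hw : w ∈ W) :
      S.proj (Fin.last p) (S.A w) ∈ W₁ ⊔ W₂ :=
    Submodule.mem_sup_right ⟨w, hw, rfl⟩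
  have mA {w : LinearMap.ker (S.proj (Fin.last p))} (hw : w ∈ W) : S.A w ∈ W₁ ⊔ W₂ := by
    have := (W₁ ⊔ W₂).add_mem (m₁ (h₂ w hw)) (m₂ hw)
    rwa [hcA, sub_add_cancel] at this
  have hg : ∀ i, ∀ v ∈ W₁ ⊔ W₂, S.proj i v ∈ W₁ ⊔ W₂ := by
    intro i
    change W₁ ⊔ W₂ ≤ (W₁ ⊔ W₂).comap (S.proj i)
    refine sup_le ?_ ?_
    · rintro _ ⟨w, hw, rfl⟩
      change S.proj i (w : S.V) ∈ W₁ ⊔ W₂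
      refine Fin.lastCases ?_ (fun i => ?_) i
      · rw [hPW]
        exact Submodule.zero_mem _
      · rw [← S.compress_proj_apply]
        exact m₁ (h₁ i w hw)
    · rintro _ ⟨w, hw, rfl⟩
      change S.proj i (S.proj (Fin.last p) (S.A w)) ∈ W₁ ⊔ W₂
      by_cases hi : i = Fin.last p
      · rw [hi, hPP]
        exact m₂ hw
      · rw [S.proj_proj_of_ne hi]
        exact Submodule.zero_mem _
  have hs : ∀ v ∈ W₁ ⊔ W₂, S.A v ∈ W₁ ⊔ W₂ := by
    change W₁ ⊔ W₂ ≤ (W₁ ⊔ W₂).comap S.A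
    refine sup_le ?_ ?_
    · rintro _ ⟨w, hw, rfl⟩
      exact mA hw
    · rintro _ ⟨w, hw, rfl⟩
      change S.A (S.proj (Fin.last p) (S.A w)) ∈ W₁ ⊔ W₂
      have e : S.A (S.proj (Fin.last p) (S.A w)) =
          (μ₁ + μ₂) • S.A w - (μ₁ * μ₂) • (w : S.V) - S.A (S.compress S.A w) := by
        rw [← quad_eq_zero_apply hq, hcA, map_sub, sub_sub_cancel]
      rw [e]
      exact Submodule.sub_mem _ (Submodule.sub_mem _ (Submodule.smul_mem _ _ (mA hw))
        (Submodule.smul_mem _ _ (m₁ hw))) (mA (h₂ w hw))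
  rcases h _ hg hs with h0 | h0
  · left
    refine (Submodule.eq_bot_iff W).2 fun w hw => Subtype.ext ?_
    have := m₁ hw
    rwa [h0, Submodule.mem_bot] at this
  · right
    refine (Submodule.eq_top_iff').2 fun x => ?_
    have hx : (x : S.V) ∈ W₁ ⊔ W₂ := by rw [h0]; trivial
    obtain ⟨_, ⟨w, hw, rfl⟩, _, ⟨w', hw', rfl⟩, hxw⟩ := Submodule.mem_sup.1 hx
    change (w : S.V) + S.proj (Fin.last p) (S.A w') = x at hxw
    have h4 := congrArg (S.proj (Fin.last p)) hxw
    rw [map_add, hPW, hPW, hPP, zero_add] at h4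
    rw [h4, add_zero] at hxw
    rwa [← Subtype.ext hxw]

theorem IsBlockIrred.finrank_le_one {S : OkuboSystem.{u} p} (h : S.IsBlockIrred) {σ : ℂ}
    (hA : ∀ v, S.A v = σ • v) : S.rank ≤ 1 := by
  by_contra hr
  have hV : Nontrivial S.V := Module.nontrivial_of_finrank_pos (R := ℂ) (by
    unfold rank at hr; omega)
  obtain ⟨v, hv⟩ := exists_ne (0 : S.V)
  obtain ⟨i, hi⟩ : ∃ i, S.proj i v ≠ 0 := by
    by_contra! hc
    exact hv (by rw [← S.sum_proj_apply v]; exact Finset.sum_eq_zero fun i _ => hc i)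
  have hW := h (Submodule.span ℂ {S.proj i v}) (fun k w hw => ?_) (fun w hw => ?_)
  · rcases hW with hW | hW
    · exact hi (Submodule.span_singleton_eq_bot.1 hW)
    · have h1 := finrank_span_singleton (K := ℂ) hi
      rw [hW, finrank_top] at h1
      exact hr h1.le
  · obtain ⟨c, rfl⟩ := Submodule.mem_span_singleton.1 hw
    rw [map_smul]
    refine Submodule.smul_mem _ _ ?_
    by_cases hk : k = i
    · rw [hk, proj_proj]
      exact Submodule.mem_span_singleton_self _
    · rw [proj_proj_of_ne S hk]
      exact Submodule.zero_mem _
  · rw [hA]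
    exact Submodule.smul_mem _ _ hw

theorem IsLinIrred.A_injective {S : OkuboSystem.{u} p} (h : S.IsLinIrred) (hr : 2 ≤ S.rank) :
    Function.Injective S.A := by
  have hI : ∀ W : Submodule ℂ S.V, (∀ i, ∀ v ∈ W, S.proj i (S.A v) ∈ W) →
      W = ⊥ ∨ W = ⊤ := h
  rw [← LinearMap.ker_eq_bot]
  refine (hI (LinearMap.ker S.A) fun i v hv => ?_).resolve_right fun ht => ?_
  · change S.A (S.proj i (S.A v)) = 0
    rw [LinearMap.mem_ker.1 hv, map_zero, map_zero]
  · have := h.isBlockIrred.finrank_le_one (σ := 0) fun v => by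
      have : v ∈ LinearMap.ker S.A := by rw [ht]; trivial
      rw [zero_smul]
      exact this
    omega

/-- An eigenvector inside one block would span a stable line, which is proper in rank at least 2. -/
theorem IsBlockIrred.eigenvector_proj {S : OkuboSystem.{u} p} (h : S.IsBlockIrred)
    (hr : 2 ≤ S.rank) (σ : ℂ) (i : Fin p) {v : S.V} (hv : S.proj i v = v)
    (hA : S.A v = σ • v) : v = 0 := by
  by_contra h0
  have hW := h (Submodule.span ℂ {v}) (fun k w hw => ?_) (fun w hw => ?_)
  · rcases hW with hW | hW
    · exact h0 (Submodule.span_singleton_eq_bot.1 hW)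
    · have h1 := finrank_span_singleton (K := ℂ) h0
      rw [hW, finrank_top] at h1
      unfold rank at hr
      omega
  · obtain ⟨c, rfl⟩ := Submodule.mem_span_singleton.1 hw
    rw [map_smul]
    refine Submodule.smul_mem _ _ ?_
    by_cases hk : k = i
    · rw [hk, hv]
      exact Submodule.mem_span_singleton_self _
    · rw [← hv, proj_proj_of_ne S hk]
      exact Submodule.zero_mem _
  · obtain ⟨c, rfl⟩ := Submodule.mem_span_singleton.1 hw
    rw [map_smul, hA]
    exact Submodule.smul_mem _ _ (Submodule.smul_mem _ _ (Submodule.mem_span_singleton_self _))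

/-- Dual to `eigenvector_proj`: the vectors whose `i`-th component lies in `Im P_i (A - σ)` form a
stable subspace containing `Im (A - σ)`. If it were zero, `A` would be the scalar `σ`, which forces
rank at most 1. -/
theorem IsBlockIrred.exists_proj_sub {S : OkuboSystem.{u} p} (h : S.IsBlockIrred)
    (hr : 2 ≤ S.rank) (σ : ℂ) (i : Fin p) (v : S.V) :
    ∃ w, S.proj i (S.A w - σ • w) = S.proj i v := by
  let M : Module.End ℂ S.V := S.proj i * (S.A - σ • 1)
  let N : Submodule ℂ S.V := (LinearMap.range M).comap (S.proj i)
  have hN (v) : v ∈ N ↔ ∃ w, S.proj i (S.A w - σ • w) = S.proj i v := Iff.rfl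
  have hd (v) : S.A v - σ • v ∈ N := (hN _).2 ⟨v, rfl⟩
  have hN₁ : ∀ k, ∀ v ∈ N, S.proj k v ∈ N := fun k v hv => by
    by_cases hk : k = i
    · subst hk
      rw [hN, proj_proj]
      exact hv
    · rw [hN, proj_proj_of_ne S (Ne.symm hk)]
      exact ⟨0, by simp⟩
  have hN₂ : ∀ v ∈ N, S.A v ∈ N := fun v hv => by
    have := N.add_mem (hd v) (N.smul_mem σ hv)
    rwa [sub_add_cancel] at this
  rcases h N hN₁ hN₂ with h0 | h0
  · have := h.finrank_le_one (σ := σ) fun v => by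
      have h1 := hd v
      rwa [h0, Submodule.mem_bot, sub_eq_zero] at h1
    omega
  · rw [← hN, h0]
    trivial

theorem euler_zero (S : OkuboSystem.{u} p) : S.euler 0 = S := by
  cases S
  simp [euler]

theorem restrictDefined_extend_euler {S : OkuboSystem.{u} p} (h : S.IsBlockIrred) {σ₁ σ₂ ε : ℂ}
    (h₁ : σ₁ + ε ≠ 0) (h₂ : σ₂ + ε ≠ 0) (j : Fin p)
    (hj : ∀ v, S.proj j v = v → S.proj j (S.A v) = (σ₁ + σ₂ + ε) • v → v = 0) :
    ((S.extend σ₁ σ₂).euler ε).RestrictDefined j := by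
  have hq : (((S.extend σ₁ σ₂).euler ε).permute (Equiv.swap j.castSucc (Fin.last p))).quad
      (σ₁ + ε) (σ₂ + ε) = 0 := (quad_euler _ σ₁ σ₂ ε).trans (quad_extend S σ₁ σ₂)
  refine ⟨(((h.extend σ₁ σ₂).euler ε).permute _).isLinIrred (A_injective_of_quad hq h₁ h₂),
    σ₁ + ε, σ₂ + ε, hq, fun he => ?_⟩
  obtain ⟨x, hx⟩ := he.exists_hasEigenvector
  obtain ⟨⟨x, y, rfl⟩, hx0⟩ : ∃ z, z = x := ⟨x, rfl⟩
  subst hx0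
  set R := LinearMap.range (S.quad σ₁ σ₂) with hR
  have h3 : S.extProj R (Equiv.swap j.castSucc (Fin.last p) (Fin.last p))
      (((S.extend σ₁ σ₂).euler ε).A
        (S.extProj R (Equiv.swap j.castSucc (Fin.last p) (Fin.last p)) y)) =
      (((σ₁ + ε + (σ₂ + ε)) •
        S.extProj R (Equiv.swap j.castSucc (Fin.last p) (Fin.last p)) y : S.V × R)) :=
    congrArg Subtype.val hx.apply_eq_smul
  have h4 : S.extProj R (Equiv.swap j.castSucc (Fin.last p) (Fin.last p)) y ≠
      (0 : S.V × R) := fun h0 => hx.2 (Subtype.ext h0)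
  rw [extProj_swap_last] at h3 h4
  obtain ⟨v, r⟩ : S.V × R := y
  -- After the swap the deleted block is `V_j` with diagonal part `A_jj + ε`, while the two roots
  -- add up to `σ₁ + σ₂ + 2ε`. The value to be avoided by `A_jj` is thus `σ₁ + σ₂ + ε`.
  have h5 := congrArg Prod.fst h3
  change S.proj j (S.A (S.proj j v) + (0 : S.V) + ε • S.proj j v) =
    (σ₁ + ε + (σ₂ + ε)) • S.proj j v at h5
  refine h4 (Prod.ext (hj _ (S.proj_proj j v) ?_) rfl)
  change S.proj j (S.A (S.proj j v)) = _ • S.proj j v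
  rw [add_zero, map_add, map_smul, proj_proj, ← eq_sub_iff_add_eq] at h5
  rw [h5]
  module

/-- The space of the result is `ker P_j × Im (A - σ₁)(A - σ₂)`. -/
theorem rank_extendRestrict (j : Fin p) (σ₁ σ₂ ε : ℂ) (S : OkuboSystem.{u} p) :
    (S.extendRestrict j σ₁ σ₂ ε).rank + Module.finrank ℂ (LinearMap.range (S.proj j)) =
      S.rank + Module.finrank ℂ (LinearMap.range (S.quad σ₁ σ₂)) := by
  let f : (S.extendRestrict j σ₁ σ₂ ε).V →ₗ[ℂ]
      LinearMap.ker (S.proj j) × LinearMap.range (S.quad σ₁ σ₂) :=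
    LinearMap.prod (LinearMap.codRestrict _ (S.erFst j σ₁ σ₂ ε) proj_erFst)
      (S.erSnd j σ₁ σ₂ ε)
  have hf : Function.Bijective f := by
    refine ⟨fun x y hxy => er_ext ?_ ?_, fun x => ⟨S.erMk j σ₁ σ₂ ε (x.1, x.2), ?_⟩⟩
    · exact congrArg (fun z => (z.1 : S.V)) hxy
    · have h2 := congrArg Prod.snd hxy
      exact h2
    · refine Prod.ext (Subtype.ext ?_) rfl
      change (x.1 : S.V) - S.proj j x.1 = x.1
      rw [LinearMap.mem_ker.1 x.1.2, sub_zero]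
  have h1 := (LinearEquiv.ofBijective f hf).finrank_eq
  rw [Module.finrank_prod] at h1
  have h2 := LinearMap.finrank_range_add_finrank_ker (S.proj j)
  unfold rank
  omega

end OkuboSystem

/-! ### The relations for generic `ε` -/

open Filter in
theorem Module.End.eventually_cofinite_injective {U : Type u} [AddCommGroup U] [Module ℂ U]
    [FiniteDimensional ℂ U] (f : Module.End ℂ U) (c : ℂ) :
    ∀ᶠ ε in cofinite, ∀ u, (c + ε) • u + f u = 0 → u = 0 := by
  have hfin : {μ | f.HasEigenvalue μ}.Finite := Module.End.finite_hasEigenvalue f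
  have hinj : Function.Injective fun ε : ℂ => -(c + ε) := fun x y h => by simpa using h
  refine (hfin.preimage hinj.injOn).subset fun ε hε => ?_
  simp only [Set.mem_compl_iff, Set.mem_ofPred_eq, not_forall] at hε
  obtain ⟨u, hu, hu0⟩ := hε
  refine Module.End.hasEigenvalue_of_hasEigenvector (x := u)
    ⟨Module.End.mem_eigenspace_iff.2 ?_, hu0⟩
  rw [neg_smul]
  exact (neg_eq_of_add_eq_zero_right hu).symm

namespace OkuboSystem

variable {p : ℕ}

open Filter in
theorem eventually_extendRestrict_sim_of_factor {S : OkuboSystem.{u} p} (hirr : S.IsLinIrred)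
    (hrank : 2 ≤ S.rank) (j : Fin p) {ρ₁ ρ₂ : ℂ} (hρ₁ : ρ₁ ≠ 0) (hρ₂ : ρ₂ ≠ 0) (ρ₃ : ℂ)
    (M : ResidueTuple.{u} p) (α : M.V →ₗ[ℂ] S.V) (b : S.V →ₗ[ℂ] M.V)
    (hα : Function.Injective α) (hbs : Function.Surjective b)
    (hab : ∀ v, S.A v = ρ₁ • v + α (b v)) (hmc : ∀ i u, M.mat i u = b (S.proj i (α u))) :
    ∀ᶠ ε in cofinite,
      S.ExtendDefined ρ₁ ρ₂ ∧
      (S.extend ρ₁ ρ₂).EulerDefined ε ∧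
      ((S.extend ρ₁ ρ₂).euler ε).RestrictDefined j ∧
      (S.extendRestrict j ρ₁ ρ₂ ε).ExtendDefined (ρ₁ + ε) (ρ₁ + ρ₂ + ρ₃ + ε) ∧
      ((S.extendRestrict j ρ₁ ρ₂ ε).extend (ρ₁ + ε) (ρ₁ + ρ₂ + ρ₃ + ε)).RestrictDefined j ∧
      (S.extendRestrict j ρ₁ ρ₂ ε).toTuple.Sim
        (((M.swapInfty j).addition (Pi.single j (ρ₂ - ρ₁))).mc (ρ₁ + ε)) ∧
      (((S.extendRestrict j ρ₁ ρ₂ ε).extend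
          (ρ₁ + ε) (ρ₁ + ρ₂ + ρ₃ + ε)).restrict j).toTuple.Sim
        ((M.addition (Pi.single j (ρ₁ + ρ₃))).mc (ρ₁ + ε)) := by
  have hA := hirr.A_injective hrank
  have hAu : IsUnit S.A := (LinearMap.isUnit_iff_ker_eq_bot _).2 (LinearMap.ker_eq_bot.2 hA)
  have hb := hirr.isBlockIrred
  have hsi (σ : ℂ) (i v) := hb.exists_proj_sub hrank σ i v
  have hs : ∀ i, i ≠ j → ∀ v, ∃ u, S.proj i (α u) = S.proj i v := fun i _ v => by
    obtain ⟨w, hw⟩ := hsi ρ₁ i v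
    exact ⟨b w, by rw [← hw, hab, add_sub_cancel_left]⟩
  have hi : ∀ i, i ≠ j → ∀ v, b (S.proj i v) = 0 → S.proj i v = 0 := fun i _ v hv =>
    hb.eigenvector_proj hrank ρ₁ i (S.proj_proj i v) (by rw [hab, hv, map_zero, add_zero])
  let C := (M.swapInfty j).addition (Pi.single j (ρ₂ - ρ₁))
  let C' := M.addition (Pi.single j (ρ₁ + ρ₃))
  have hsum (u : M.V) : ∑ i, M.mat i u = b (α u) := by
    simp only [hmc]
    rw [← map_sum, sum_proj_apply]
  have hCne (i) (h : i ≠ j) (u : M.V) : C.mat i u = b (S.proj i (α u)) := by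
    change (Function.update M.mat j (-∑ i, M.mat i) i +
      (Pi.single j (ρ₂ - ρ₁) : Fin p → ℂ) i • (1 : Module.End ℂ M.V)) u = _
    rw [Function.update_of_ne h, Pi.single_eq_of_ne h, zero_smul, add_zero, hmc]
  have hCj (u : M.V) : C.mat j u = (ρ₂ - ρ₁) • u - b (α u) := by
    change (Function.update M.mat j (-∑ i, M.mat i) j +
      (Pi.single j (ρ₂ - ρ₁) : Fin p → ℂ) j • (1 : Module.End ℂ M.V)) u = _
    rw [Function.update_self, Pi.single_eq_same, LinearMap.add_apply, LinearMap.neg_apply,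
      LinearMap.sum_apply, hsum, LinearMap.smul_apply, Module.End.one_apply]
    abel
  have hCne' (i) (h : i ≠ j) (u : M.V) : C'.mat i u = b (S.proj i (α u)) := by
    change (M.mat i + (Pi.single j (ρ₁ + ρ₃) : Fin p → ℂ) i • (1 : Module.End ℂ M.V)) u = _
    rw [Pi.single_eq_of_ne h, zero_smul, add_zero, hmc]
  have hCj' (u : M.V) : C'.mat j u = b (S.proj j (α u)) + (ρ₁ + ρ₃) • u := by
    change (M.mat j + (Pi.single j (ρ₁ + ρ₃) : Fin p → ℂ) j • (1 : Module.End ℂ M.V)) u = _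
    rw [Pi.single_eq_same, LinearMap.add_apply, hmc, LinearMap.smul_apply, Module.End.one_apply]
  -- Every tuple on `U` met below differs from `M` only at the place `j`, so its sum follows from `∑
  -- M_i = b α`.
  have hrec (g : Fin p → M.V) (u : M.V) (hg : ∀ i, i ≠ j → g i = b (S.proj i (α u))) :
      ∑ i, g i = g j - b (S.proj j (α u)) + b (α u) := by
    rw [← hsum u, ← sub_eq_iff_eq_add, ← Finset.sum_sub_distrib, Finset.sum_eq_single j]
    · rw [hmc]
    · intro i _ h
      rw [hg i h, hmc, sub_self]
    · simp
  -- The first three values keep the shifted parameters non-zero. The remaining conditions are, in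
  -- order: the first restriction is defined; `(ρ₁ + ε) + ψ β` is injective; and `(2ρ₁ + ρ₃ + ε) + b
  -- α` is injective, which serves both the second restriction and the second middle convolution.
  filter_upwards [eventually_cofinite_ne (-ρ₁), eventually_cofinite_ne (-ρ₂),
    eventually_cofinite_ne (-(ρ₁ + ρ₂ + ρ₃)),
    Module.End.eventually_cofinite_injective (-(S.proj j * S.A)) (ρ₁ + ρ₂),
    Module.End.eventually_cofinite_injective
      ((ρ₂ - ρ₁) • LinearMap.id - b ∘ₗ S.proj j ∘ₗ α) ρ₁,
    Module.End.eventually_cofinite_injective (b ∘ₗ α) (2 * ρ₁ + ρ₃)]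
    with ε h₁ h₂ h₃ hPA hC hd
  replace h₁ : ρ₁ + ε ≠ 0 := fun h => h₁ (eq_neg_of_add_eq_zero_right h)
  replace h₂ : ρ₂ + ε ≠ 0 := fun h => h₂ (eq_neg_of_add_eq_zero_right h)
  replace h₃ : ρ₁ + ρ₂ + ρ₃ + ε ≠ 0 := fun h => h₃ (eq_neg_of_add_eq_zero_right h)
  have hq := S.quad_extend ρ₁ ρ₂
  have hR : ((S.extend ρ₁ ρ₂).euler ε).RestrictDefined j :=
    restrictDefined_extend_euler hb h₁ h₂ j fun v _ hv => hPA v (by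
      rw [LinearMap.neg_apply, Module.End.mul_apply, hv, add_neg_cancel])
  have hfac := exists_factor_extendRestrict j ρ₁ ρ₂ ε S α b hα hbs hab hs hi
  have hZb : (S.extendRestrict j ρ₁ ρ₂ ε).IsBlockIrred :=
    (((hb.extend ρ₁ ρ₂).euler ε).permute _).restrictLast ((quad_euler _ ρ₁ ρ₂ ε).trans hq)
  -- From here on only the factorization and the block irreducibility of the restricted system
  -- matter.
  generalize S.extendRestrict j ρ₁ ρ₂ ε = Z at hfac hZb ⊢
  obtain ⟨β, ψ, hβA, hβne, hβj, hβs, hβi, hβinj, hψsurj⟩ := hfac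
  replace hβinj := hβinj fun v hv hv' => hb.eigenvector_proj hrank ρ₂ j hv hv'
  replace hψsurj := hψsurj fun v => hsi ρ₂ j v
  have hψβ (u) : ψ (β u) = (ρ₂ - ρ₁) • u - b (S.proj j (α u)) := by
    rw [← Z.sum_proj_apply (β u), map_sum, hrec _ u fun i h => hβne i h u, hβj]
    abel
  have hne (u) : (ρ₁ + ε) • u + ψ (β u) = 0 → u = 0 := fun hu => hC u (by
    rw [← hu, hψβ]
    rfl)
  have hZA : Function.Injective Z.A := by
    rw [← LinearMap.ker_eq_bot, LinearMap.ker_eq_bot']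
    intro x hx
    rw [hβA] at hx
    have h0 : ψ x = 0 := hne _ (by rw [← map_smul, ← map_add, hx, map_zero])
    rw [h0, map_zero, add_zero] at hx
    exact (smul_eq_zero.1 hx).resolve_left h₁
  have hZE : Z.ExtendDefined (ρ₁ + ε) (ρ₁ + ρ₂ + ρ₃ + ε) :=
    ⟨hZb.isLinIrred hZA, (LinearMap.isUnit_iff_ker_eq_bot _).2 (LinearMap.ker_eq_bot.2 hZA),
      h₁, h₃⟩
  have hR' : (Z.extend (ρ₁ + ε) (ρ₁ + ρ₂ + ρ₃ + ε)).RestrictDefined j := by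
    -- The second round has no Euler shift, hence `ε := 0`. Applying `ψ` to the eigenvalue equation
    -- on the block `j`, where `ψ P_j β = γ`, yields `((2ρ₁ + ρ₃ + ε) + b α) (ψ x) = 0`.
    have := restrictDefined_extend_euler hZb (σ₁ := ρ₁ + ε) (σ₂ := ρ₁ + ρ₂ + ρ₃ + ε) (ε := 0)
      (by rwa [add_zero]) (by rwa [add_zero]) j fun x hx hx' => by
        have h4 : ψ x = 0 := hd _ (by
          rw [hβA, map_add, map_smul, hx] at hx'
          have h5 := congrArg ψ hx'
          rw [map_add, map_smul, hβj, map_smul] at h5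
          rw [LinearMap.comp_apply, ← sub_eq_zero.2 h5.symm]
          module)
        rw [← hx] at h4 ⊢
        exact hβi j x h4
    rwa [euler_zero] at this
  refine ⟨⟨hirr, hAu, hρ₁, hρ₂⟩, eulerDefined_of_quad hq h₁ h₂, hR, hZE, hR', ?_, ?_⟩
  · refine ResidueTuple.sim_mc_of_factor h₁ C Z.toTuple Z.complete ψ β
      (fun i x => congrArg (Z.proj i) (hβA x)) (fun i u => ?_) hβs hβi hne
    by_cases h : i = j
    · subst h
      exact (hCj u).trans (hβj u).symm
    · exact (hCne i h u).trans (hβne i h u).symm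
  · obtain ⟨β', ψ', hβA', hβne', hβj', hβs', hβi', -, -⟩ :=
      exists_factor_extendRestrict j (ρ₁ + ε) (ρ₁ + ρ₂ + ρ₃ + ε) 0 Z β ψ hβinj hψsurj hβA
        (fun i _ v => hβs i v) (fun i _ v => hβi i v)
    have hmat (i) (u : M.V) : C'.mat i u =
        ψ' ((Z.extendRestrict j (ρ₁ + ε) (ρ₁ + ρ₂ + ρ₃ + ε) 0).proj i (β' u)) := by
      by_cases h : i = j
      · subst h
        refine (hCj' u).trans ((hβj' u).trans ?_).symm
        rw [hψβ]
        module
      · exact (hCne' i h u).trans ((hβne' i h u).trans (hβne i h u)).symm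
    -- Here `ψ' β' = (ρ₁ + ρ₃) + b α`, so the condition is again `hd`.
    have hne' (u : M.V) (hu : (ρ₁ + ε) • u + ψ' (β' u) = 0) : u = 0 := hd u (by
      rw [← sum_proj_apply _ (β' u), map_sum,
        hrec _ u fun i h => (hβne' i h u).trans (hβne i h u), hβj', hψβ] at hu
      rw [LinearMap.comp_apply, ← hu]
      module)
    rw [add_zero] at hβA'
    have := ResidueTuple.sim_mc_of_factor h₁ C'
      (Z.extendRestrict j (ρ₁ + ε) (ρ₁ + ρ₂ + ρ₃ + ε) 0).toTuple
      (Z.extendRestrict j (ρ₁ + ε) (ρ₁ + ρ₂ + ρ₃ + ε) 0).complete ψ' β'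
      (fun i x => congrArg
        ((Z.extendRestrict j (ρ₁ + ε) (ρ₁ + ρ₂ + ρ₃ + ε) 0).proj i) (hβA' x)) hmat hβs' hβi' hne'
    rwa [extendRestrict, euler_zero] at this

open Filter in
theorem eventually_extendRestrict_sim {S : OkuboSystem.{u} p} (hirr : S.IsLinIrred)
    (hrank : 2 ≤ S.rank) (j : Fin p) {ρ₁ ρ₂ : ℂ} (hρ₁ : ρ₁ ≠ 0) (hρ₂ : ρ₂ ≠ 0) (ρ₃ : ℂ) :
    ∀ᶠ ε in cofinite,
      S.ExtendDefined ρ₁ ρ₂ ∧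
      (S.extend ρ₁ ρ₂).EulerDefined ε ∧
      ((S.extend ρ₁ ρ₂).euler ε).RestrictDefined j ∧
      (S.extendRestrict j ρ₁ ρ₂ ε).ExtendDefined (ρ₁ + ε) (ρ₁ + ρ₂ + ρ₃ + ε) ∧
      ((S.extendRestrict j ρ₁ ρ₂ ε).extend (ρ₁ + ε) (ρ₁ + ρ₂ + ρ₃ + ε)).RestrictDefined j ∧
      (S.extendRestrict j ρ₁ ρ₂ ε).toTuple.Sim
        ((((S.toTuple.mc (-ρ₁)).swapInfty j).addition (Pi.single j (ρ₂ - ρ₁))).mc (ρ₁ + ε)) ∧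
      (((S.extendRestrict j ρ₁ ρ₂ ε).extend
          (ρ₁ + ε) (ρ₁ + ρ₂ + ρ₃ + ε)).restrict j).toTuple.Sim
        (((S.toTuple.mc (-ρ₁)).addition (Pi.single j (ρ₁ + ρ₃))).mc (ρ₁ + ε)) := by
  have hA : IsUnit S.A := (LinearMap.isUnit_iff_ker_eq_bot _).2
    (LinearMap.ker_eq_bot.2 (hirr.A_injective hrank))
  obtain ⟨α, b, hα, hb, hab, hmc⟩ := exists_mc_factor hρ₁ S hA
  exact eventually_extendRestrict_sim_of_factor hirr hrank j hρ₁ hρ₂ ρ₃ _ α b hα hb hab hmc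

/-- Since `A` is onto, `Im P_j A = Im P_j`; this turns the block dimension lost in
`rank_extendRestrict` into `dim Im A_j`. -/
theorem finrank_range_toTuple_mat (S : OkuboSystem.{u} p) (hA : IsUnit S.A) (j : Fin p) :
    Module.finrank ℂ (LinearMap.range (S.toTuple.mat j)) =
      Module.finrank ℂ (LinearMap.range (S.proj j)) := by
  obtain ⟨Ai, hAi⟩ := hA.exists_right_inv
  have h : LinearMap.range (S.proj j * S.A) = LinearMap.range (S.proj j) :=
    LinearMap.range_comp_of_range_eq_top _
      (LinearMap.range_eq_top.2 fun v => ⟨Ai v, LinearMap.congr_fun hAi v⟩)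
  change Module.finrank ℂ (LinearMap.range (S.proj j * S.A)) = _
  rw [h]

end OkuboSystem

theorem mainTheorem9 {p : ℕ} (S : OkuboSystem.{u} p) (hirr : S.IsLinIrred)
    (hrank : 2 ≤ S.rank) (j : Fin p) (ρ₁ ρ₂ : ℂ) (hρ₁ : ρ₁ ≠ 0) (hρ₂ : ρ₂ ≠ 0) :
    (∃ F : Set ℂ, F.Finite ∧ ∀ ε ∉ F,
      (S.ExtendDefined ρ₁ ρ₂ ∧
        (S.extend ρ₁ ρ₂).EulerDefined ε ∧
        ((S.extend ρ₁ ρ₂).euler ε).RestrictDefined j) ∧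
      (((S.extend ρ₁ ρ₂).euler ε).restrict j).toTuple.Sim
        ((((S.toTuple.mc (-ρ₁)).swapInfty j).addition (Pi.single j (ρ₂ - ρ₁))).mc (ρ₁ + ε)) ∧
      ((((S.extend ρ₁ ρ₂).euler ε).restrict j).rank : ℤ) =
        S.rank + Module.finrank ℂ (LinearMap.range ((S.A - ρ₁ • 1) * (S.A - ρ₂ • 1)))
          - Module.finrank ℂ (LinearMap.range (S.toTuple.mat j))) ∧
    (∀ ρ₃ : ℂ, ∃ F : Set ℂ, F.Finite ∧ ∀ ε ∉ F,
      (S.ExtendDefined ρ₁ ρ₂ ∧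
        (S.extend ρ₁ ρ₂).EulerDefined ε ∧
        ((S.extend ρ₁ ρ₂).euler ε).RestrictDefined j ∧
        (((S.extend ρ₁ ρ₂).euler ε).restrict j).ExtendDefined
          (ρ₁ + ε) (ρ₁ + ρ₂ + ρ₃ + ε) ∧
        ((((S.extend ρ₁ ρ₂).euler ε).restrict j).extend
          (ρ₁ + ε) (ρ₁ + ρ₂ + ρ₃ + ε)).RestrictDefined j) ∧
      (((((S.extend ρ₁ ρ₂).euler ε).restrict j).extend
          (ρ₁ + ε) (ρ₁ + ρ₂ + ρ₃ + ε)).restrict j).toTuple.Sim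
        (((S.toTuple.mc (-ρ₁)).addition (Pi.single j (ρ₁ + ρ₃))).mc (ρ₁ + ε))) := by
  have h := fun ρ₃ => OkuboSystem.eventually_extendRestrict_sim hirr hrank j hρ₁ hρ₂ ρ₃
  -- Part 1 does not involve `ρ₃`, so the value `0` is an arbitrary choice.
  refine ⟨⟨_, h 0, fun ε hε => ?_⟩, fun ρ₃ => ⟨_, h ρ₃, fun ε hε => ?_⟩⟩
  · obtain ⟨hE, hEu, hR, -, -, hsim, -⟩ := Classical.not_not.1 hε
    refine ⟨⟨hE, hEu, hR⟩, hsim, ?_⟩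
    have h1 := S.rank_extendRestrict j ρ₁ ρ₂ ε
    rw [← S.finrank_range_toTuple_mat hE.2.1] at h1
    exact eq_sub_of_add_eq (by exact_mod_cast h1)
  · obtain ⟨hE, hEu, hR, hE', hR', -, hsim⟩ := Classical.not_not.1 hε
    exact ⟨⟨hE, hEu, hR, hE', hR'⟩, hsim⟩
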